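/- Let $(X,\mathcal S)$ be a measurable space and let $\mathcal C\subseteq\mathcal S$ be a family of measurable sets. Suppose that $\mathcal C$ is a VC class, i.e. there is a finite bound on the cardinality of the finite sets $D\subseteq X$ that $\mathcal C$ shatters (those with $\{A\cap D: A\in\mathcal C\}=2^D$), and that $\mathcal C$ is separable, i.e. there is a countable $\mathcal C_0\subseteq\mathcal C$ such that the indicator function $1_A$ of each $A\in\mathcal C$ is the pointwise limit of a sequence of indicator functions of members of $\mathcal C_0$. Then for every probability measure $\mu$ on $(X,\mathcal S)$ and every $\varepsilon>0$ the bracketing number $N_{[\,]}(\varepsilon,\mathcal C,\mu)$ is finite. Here $N_{[\,]}(\varepsilon,\mathcal C,\mu)$ is the least number of $\varepsilon$-brackets needed to cover $\{1_A:A\in\mathcal C\}$, where an $\varepsilon$-bracket is a set $[g,h]$ of all measurable $f:X\to\mathbb R$ with $g\le f\le h$ pointwise, for measurable $g\le h:X\to\mathbb R$ with $\int (h-g)\,d\mu\le\varepsilon$. -/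

import Mathlib

open MeasureTheory Filter Topology

noncomputable section

namespace VCBracketing

/-- The family `C` shatters the finite set `D` if its members select every subset of `D`. -/
def Shatters {X : Type*} (C : Set (Set X)) (D : Finset X) : Prop :=
  ∀ T : Finset X, T ⊆ D → ∃ A ∈ C, A ∩ (D : Set X) = (T : Set X)

/-- The Vapnik-Chervonenkis dimension: the largest cardinality of a finite set shattered by `C`,
and `⊤` if `C` shatters arbitrarily large finite sets. -/
def vcDimension {X : Type*} (C : Set (Set X)) : ℕ∞ :=
  ⨆ D : {D : Finset X // Shatters C D}, (D.1.card : ℕ∞)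

/-- A VC class is a family of sets of finite VC dimension. -/
def IsVCClass {X : Type*} (C : Set (Set X)) : Prop :=
  vcDimension C < ⊤

/-- The family of indicator functions of the members of `C`. -/
def indicatorFamily {X : Type*} (C : Set (Set X)) : Set (X → ℝ) :=
  (fun A : Set X => A.indicator (fun _ => (1 : ℝ))) '' C

/-- A family of functions is separable if it has a countable sub-family such that each member of
the family is the pointwise limit of a sequence in the sub-family. -/
def IsSeparableFamily {X : Type*} (F : Set (X → ℝ)) : Prop :=
  ∃ F₀ : Set (X → ℝ), F₀ ⊆ F ∧ F₀.Countable ∧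
    ∀ f ∈ F, ∃ u : ℕ → X → ℝ, (∀ n, u n ∈ F₀) ∧
      ∀ x, Tendsto (fun n => u n x) atTop (𝓝 (f x))

/-- The bracket `[g, h]`: all measurable functions lying pointwise between `g` and `h`. -/
def bracket {X : Type*} [MeasurableSpace X] (g h : X → ℝ) : Set (X → ℝ) :=
  {f | Measurable f ∧ ∀ x, g x ≤ f x ∧ f x ≤ h x}

/-- `[g, h]` is an `ε`-bracket: `g ≤ h` are measurable and the integral of the nonnegative function
`h - g` is at most `ε` (in particular it is finite). -/
def IsEpsBracket {X : Type*} [MeasurableSpace X] (μ : Measure X) (ε : ℝ) (g h : X → ℝ) : Prop :=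
  Measurable g ∧ Measurable h ∧ (∀ x, g x ≤ h x) ∧
    ∫⁻ x, ENNReal.ofReal (h x - g x) ∂μ ≤ ENNReal.ofReal ε

/-- The bracketing number: the least number of `ε`-brackets needed to cover `F`, with value `⊤` if
no finite collection of `ε`-brackets covers `F`. A bracket is given by its pair of limits. -/
def bracketingNumber {X : Type*} [MeasurableSpace X] (ε : ℝ) (F : Set (X → ℝ)) (μ : Measure X) :
    ℕ∞ :=
  sInf {n : ℕ∞ | ∃ Θ : Set ((X → ℝ) × (X → ℝ)),
    (∀ p ∈ Θ, IsEpsBracket μ ε p.1 p.2) ∧ (F ⊆ ⋃ p ∈ Θ, bracket p.1 p.2) ∧ n = Θ.encard}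

end VCBracketing

end

/-! A family G of sets lies in the bracket from the indicator of ⋂G to that of ⋃G, whose size is the
measure of the set where members of G disagree. By separability it suffices to split the countable
subfamily into finitely many pieces of small disagreement, as brackets are closed under pointwise
limits. If this fails, let w > 0 be the supremum of the failing levels. Shrinking through
subfamilies that still fail below w, with disagreement tending to w, leaves a limit region E of
measure w. A subfamily that stays bad along this sequence must disagree almost everywhere on E, so
any finitely many non-null parts of E are all split by one member (`exists_splitting_region`).
Splitting atoms repeatedly gives arbitrarily long independent sequences, and by duality arbitrarily
large shattered sets, against the VC hypothesis. -/

/-- The region where the members of a family of sets disagree. -/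
def oscSet {X : Type*} (F : Set (Set X)) : Set X := ⋃₀ F \ ⋂₀ F

/-- `F` is a finite union of subfamilies, each disagreeing on a set of measure at most `e`. -/
def FinOscCover {X : Type*} [MeasurableSpace X] (μ : Measure X) (e : ENNReal)
    (F : Set (Set X)) : Prop :=
  ∃ T : Set (Set (Set X)), T.Finite ∧ F ⊆ ⋃₀ T ∧ ∀ G ∈ T, G ⊆ F ∧ μ (oscSet G) ≤ e

section Osc

variable {X : Type*}

theorem mem_oscSet {F : Set (Set X)} {x : X} :
    x ∈ oscSet F ↔ (∃ A ∈ F, x ∈ A) ∧ ∃ A ∈ F, x ∉ A := by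
  simp [oscSet]

theorem oscSet_mono {F G : Set (Set X)} (h : F ⊆ G) : oscSet F ⊆ oscSet G := by
  intro x hx
  rw [mem_oscSet] at hx ⊢
  obtain ⟨⟨A, hA, hxA⟩, B, hB, hxB⟩ := hx
  exact ⟨⟨A, h hA, hxA⟩, B, h hB, hxB⟩

variable [MeasurableSpace X] {μ : Measure X}

theorem measurableSet_oscSet {F : Set (Set X)} (hF : F.Countable)
    (hm : ∀ A ∈ F, MeasurableSet A) : MeasurableSet (oscSet F) :=
  (MeasurableSet.sUnion hF hm).diff (MeasurableSet.sInter hF hm)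

theorem finOscCover_of_le {F : Set (Set X)} {e : ENNReal} (h : μ (oscSet F) ≤ e) :
    FinOscCover μ e F :=
  ⟨{F}, Set.finite_singleton F, by simp, by simpa using h⟩

theorem FinOscCover.mono {F G : Set (Set X)} {e e' : ENNReal} (h : FinOscCover μ e G)
    (hFG : F ⊆ G) (he : e ≤ e') : FinOscCover μ e' F := by
  obtain ⟨T, hT, hc, hb⟩ := h
  refine ⟨(fun H => H ∩ F) '' T, hT.image _, ?_, ?_⟩
  · intro A hA
    obtain ⟨H, hH, hAH⟩ := hc (hFG hA)
    exact ⟨_, ⟨H, hH, rfl⟩, hAH, hA⟩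
  · rintro _ ⟨H, hH, rfl⟩
    exact ⟨Set.inter_subset_right,
      (measure_mono (oscSet_mono Set.inter_subset_left)).trans ((hb H hH).2.trans he)⟩

theorem FinOscCover.biUnion {ι : Type*} {s : Set ι} (hs : s.Finite) {F : ι → Set (Set X)}
    {e : ENNReal} (h : ∀ i ∈ s, FinOscCover μ e (F i)) : FinOscCover μ e (⋃ i ∈ s, F i) := by
  choose! T hT hc hb using h
  refine ⟨⋃ i ∈ s, T i, hs.biUnion hT, ?_, ?_⟩
  · intro A hA
    simp only [Set.mem_iUnion] at hA
    obtain ⟨i, hi, hA⟩ := hA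
    obtain ⟨H, hH, hAH⟩ := hc i hi hA
    exact ⟨H, Set.mem_biUnion hi hH, hAH⟩
  · intro G hG
    simp only [Set.mem_iUnion] at hG
    obtain ⟨i, hi, hG⟩ := hG
    exact ⟨(hb i hi G hG).1.trans (Set.subset_biUnion_of_mem hi), (hb i hi G hG).2⟩

/-! ### Families bad at a critical level -/

/-- Not coverable at any level below `w`. -/
def OscBad (μ : Measure X) (w : ENNReal) (F : Set (Set X)) : Prop :=
  ∀ e < w, ¬ FinOscCover μ e F

theorem OscBad.mono {F G : Set (Set X)} {w : ENNReal} (h : OscBad μ w F) (hFG : F ⊆ G) :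
    OscBad μ w G :=
  fun e he hc => h e he (hc.mono hFG le_rfl)

theorem OscBad.le_measure {F : Set (Set X)} {w : ENNReal} (h : OscBad μ w F) :
    w ≤ μ (oscSet F) :=
  not_lt.1 fun hlt => h _ hlt (finOscCover_of_le le_rfl)

/-- Finitely many levels below `w` have a maximum below `w`; positivity of `w` handles the empty
union. -/
theorem OscBad.exists_of_biUnion {ι : Type*} {s : Set ι} (hs : s.Finite) {F : ι → Set (Set X)}
    {w : ENNReal} (hw : 0 < w) (h : OscBad μ w (⋃ i ∈ s, F i)) : ∃ i ∈ s, OscBad μ w (F i) := by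
  by_contra! hcon
  have h1 : ∀ i ∈ s, ∃ e < w, FinOscCover μ e (F i) := by
    intro i hi
    have := hcon i hi
    unfold OscBad at this
    push Not at this
    exact this
  choose! e he hc using h1
  have hlt : hs.toFinset.sup e < w := by
    rw [Finset.sup_lt_iff (by simpa using hw)]
    intro i hi
    exact he i (by simpa using hi)
  refine h _ hlt (FinOscCover.biUnion hs fun i hi => (hc i hi).mono le_rfl ?_)
  exact Finset.le_sup (by simpa using hi)

theorem OscBad.exists_subset {C F : Set (Set X)} {w e : ENNReal} (hw : 0 < w)
    (h : OscBad μ w F) (hFC : F ⊆ C) (hc : FinOscCover μ e C) :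
    ∃ G ⊆ F, OscBad μ w G ∧ μ (oscSet G) ≤ e := by
  obtain ⟨T, hT, hcov, hb⟩ := hc.mono hFC le_rfl
  have : OscBad μ w (⋃ G ∈ T, id G) := h.mono (by simpa [Set.sUnion_eq_biUnion] using hcov)
  obtain ⟨G, hG, hbad⟩ := this.exists_of_biUnion hT hw
  exact ⟨G, (hb G hG).1, hbad, (hb G hG).2⟩

/-- A countable family that is not coverable at some level admits a set `E` of positive measure
such that finitely many non-null subsets of `E` are simultaneously split by one member. -/
theorem exists_splitting_region [IsFiniteMeasure μ] {C : Set (Set X)} (hC : C.Countable)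
    (hm : ∀ A ∈ C, MeasurableSet A) {e₀ : ENNReal} (he₀ : 0 < e₀) (hnc : ¬ FinOscCover μ e₀ C) :
    ∃ E : Set X, μ E ≠ 0 ∧ ∀ (ι : Type) (s : Set ι) (Q : ι → Set X), s.Finite →
      (∀ i ∈ s, Q i ⊆ E ∧ μ (Q i) ≠ 0) →
      ∃ A ∈ C, ∀ i ∈ s, μ (Q i ∩ A) ≠ 0 ∧ μ (Q i \ A) ≠ 0 := by
  set w : ENNReal := sSup {e | ¬ FinOscCover μ e C} with hwdef
  have hw : 0 < w := he₀.trans_le (le_sSup hnc)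
  have hCbad : OscBad μ w C := by
    intro e he hc
    obtain ⟨e', he', hlt⟩ := lt_sSup_iff.1 he
    exact he' (hc.mono le_rfl hlt.le)
  have hcov : ∀ e, w < e → FinOscCover μ e C := by
    intro e he
    by_contra h
    exact absurd (le_sSup (a := e) h) (not_le.2 he)
  have hwtop : w < ⊤ := hCbad.le_measure.trans_lt (measure_lt_top μ _)
  obtain ⟨δ, -, hδ, hδlim⟩ := exists_seq_strictAnti_tendsto' hwtop
  have step : ∀ (n : ℕ) (F : {F : Set (Set X) // F ⊆ C ∧ OscBad μ w F}),
      ∃ G : {F : Set (Set X) // F ⊆ C ∧ OscBad μ w F}, G.1 ⊆ F.1 ∧ μ (oscSet G.1) ≤ δ n := by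
    rintro n ⟨F, hFC, hF⟩
    obtain ⟨G, hGF, hG, hμ⟩ := hF.exists_subset hw hFC (hcov _ (hδ n).1)
    exact ⟨⟨G, hGF.trans hFC, hG⟩, hGF, hμ⟩
  choose next hnext hle using step
  let S : ℕ → {F : Set (Set X) // F ⊆ C ∧ OscBad μ w F} :=
    fun n => Nat.rec ⟨C, le_rfl, hCbad⟩ (fun n F => next n F) n
  have hSanti : Antitone fun n => (S n).1 := antitone_nat_of_succ_le fun n => hnext n (S n)
  have hSle : ∀ n, μ (oscSet (S (n + 1)).1) ≤ δ n := fun n => hle n (S n)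
  have hmeas : ∀ F ⊆ C, MeasurableSet (oscSet F) := fun F hF =>
    measurableSet_oscSet (hC.mono hF) fun A hA => hm A (hF hA)
  set E : Set X := ⋂ n, oscSet (S n).1 with hE
  have hEle : μ E ≤ w :=
    ge_of_tendsto' hδlim fun n => (measure_mono (Set.iInter_subset _ (n + 1))).trans (hSle n)
  -- The sets `oscSet (H ∩ S n)` decrease and have measure at least `w`, so their intersection,
  -- which lies in `E`, fills `E` up to a null set.
  have hlarge : ∀ H : Set (Set X), (∀ n, OscBad μ w (H ∩ (S n).1)) → μ (E \ oscSet H) = 0 := by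
    intro H hH
    set E' : Set X := ⋂ n, oscSet (H ∩ (S n).1) with hE'
    have hHC : ∀ n, H ∩ (S n).1 ⊆ C := fun n => Set.inter_subset_right.trans (S n).2.1
    have hlim := tendsto_measure_iInter_atTop (μ := μ) (s := fun n => oscSet (H ∩ (S n).1))
      (fun n => (hmeas _ (hHC n)).nullMeasurableSet)
      (fun a b hab => oscSet_mono (Set.inter_subset_inter_right _ (hSanti hab)))
      ⟨0, measure_ne_top _ _⟩
    have hge : w ≤ μ E' := ge_of_tendsto' hlim fun n => (hH n).le_measure
    have hE'E : E' ⊆ E := Set.iInter_mono fun n => oscSet_mono Set.inter_subset_right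
    have hE'm : MeasurableSet E' := MeasurableSet.iInter fun n => hmeas _ (hHC n)
    have hsub : E \ oscSet H ⊆ E \ E' := Set.sdiff_subset_sdiff_right
      ((Set.iInter_subset _ 0).trans (oscSet_mono Set.inter_subset_left))
    refine measure_mono_null hsub ?_
    rw [measure_sdiff hE'E hE'm.nullMeasurableSet (measure_ne_top _ _)]
    exact tsub_eq_zero_of_le (hEle.trans hge)
  have hμE : μ E ≠ 0 := by
    have hlim := tendsto_measure_iInter_atTop (μ := μ) (s := fun n => oscSet (S n).1)
      (fun n => (hmeas _ (S n).2.1).nullMeasurableSet)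
      (fun a b hab => oscSet_mono (hSanti hab)) ⟨0, measure_ne_top _ _⟩
    exact (hw.trans_le (ge_of_tendsto' hlim fun n => (S n).2.2.le_measure)).ne'
  refine ⟨E, hμE, fun ι s Q hs hQ => ?_⟩
  by_contra! hcon
  -- `H i true` and `H i false` collect the members almost disjoint from, resp. almost containing,
  -- the set `Q i`.
  let H : ι × Bool → Set (Set X) := fun p =>
    {A ∈ C | if p.2 then μ (Q p.1 ∩ A) = 0 else μ (Q p.1 \ A) = 0}
  have hfin : (s ×ˢ (Set.univ : Set Bool)).Finite := hs.prod Set.finite_univ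
  have hbadn : ∀ n, ∃ p ∈ s ×ˢ (Set.univ : Set Bool), OscBad μ w (H p ∩ (S n).1) := by
    intro n
    refine OscBad.exists_of_biUnion hfin hw ((S n).2.2.mono fun A hA => ?_)
    have hAC := (S n).2.1 hA
    obtain ⟨i, hi, hiA⟩ := hcon A hAC
    simp only [Set.mem_iUnion]
    by_cases h0 : μ (Q i ∩ A) = 0
    · exact ⟨(i, true), by simpa using hi, ⟨hAC, by simpa using h0⟩, hA⟩
    · exact ⟨(i, false), by simpa using hi, ⟨hAC, by simpa using hiA h0⟩, hA⟩
  -- Pigeonhole: badness passes to larger families and `S` decreases, so an index bad at a late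
  -- enough stage is bad at every stage.
  have hp : ∃ p ∈ s ×ˢ (Set.univ : Set Bool), ∀ n, OscBad μ w (H p ∩ (S n).1) := by
    by_contra! hno
    choose! N hN using hno
    obtain ⟨p, hp, hb⟩ := hbadn (hfin.toFinset.sup N)
    exact hN p hp (hb.mono (Set.inter_subset_inter_right _
      (hSanti (Finset.le_sup (by simpa using hp)))))
  obtain ⟨⟨i, b⟩, hi, hb⟩ := hp
  have hi' : i ∈ s := by simpa using hi
  have h0 := hlarge _ hb
  have hHc : (H (i, b)).Countable := hC.mono fun A hA => hA.1
  -- Countability turns memberwise null sets into a null union: members of this family almost agree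
  -- on `Q i`.
  have h1 : μ (Q i ∩ oscSet (H (i, b))) = 0 := by
    cases b with
    | true =>
      refine measure_mono_null (t := ⋃ A ∈ H (i, true), Q i ∩ A) ?_
        ((measure_biUnion_null_iff hHc).2 fun A hA => by simpa using hA.2)
      rintro x ⟨hxQ, hx⟩
      obtain ⟨⟨A, hA, hxA⟩, -⟩ := mem_oscSet.1 hx
      exact Set.mem_biUnion hA ⟨hxQ, hxA⟩
    | false =>
      refine measure_mono_null (t := ⋃ A ∈ H (i, false), Q i \ A) ?_
        ((measure_biUnion_null_iff hHc).2 fun A hA => by simpa using hA.2)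
      rintro x ⟨hxQ, hx⟩
      obtain ⟨-, A, hA, hxA⟩ := mem_oscSet.1 hx
      exact Set.mem_biUnion hA ⟨hxQ, hxA⟩
  refine (hQ i hi').2 (measure_mono_null ?_ (measure_union_null h0 h1))
  intro x hx
  by_cases hxo : x ∈ oscSet (H (i, b))
  · exact Or.inr ⟨hx, hxo⟩
  · exact Or.inl ⟨(hQ i hi').1 hx, hxo⟩

/-- A countable family that is not coverable at some level contains arbitrarily long sequences of
independent sets. -/
theorem exists_independent [IsFiniteMeasure μ] {C : Set (Set X)} (hC : C.Countable)
    (hm : ∀ A ∈ C, MeasurableSet A) {e₀ : ENNReal} (he₀ : 0 < e₀) (hnc : ¬ FinOscCover μ e₀ C)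
    (k : ℕ) : ∃ A : ℕ → Set X, (∀ i < k, A i ∈ C) ∧
      ∀ s : Set ℕ, ∃ x, ∀ i < k, x ∈ A i ↔ i ∈ s := by
  obtain ⟨E, hE0, hsplit⟩ := exists_splitting_region hC hm he₀ hnc
  suffices h : ∃ A : ℕ → Set X, (∀ i < k, A i ∈ C) ∧
      ∀ s : Set ℕ, μ {x ∈ E | ∀ i < k, x ∈ A i ↔ i ∈ s} ≠ 0 by
    obtain ⟨A, hA, h⟩ := h
    refine ⟨A, hA, fun s => ?_⟩
    obtain ⟨x, hx⟩ := nonempty_of_measure_ne_zero (h s)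
    exact ⟨x, hx.2⟩
  induction k with
  | zero => exact ⟨fun _ => ∅, by simp, by simpa using hE0⟩
  | succ k ih =>
    obtain ⟨A, hA, hpos⟩ := ih
    -- One new set splits all 2^k atoms of the sets found so far.
    obtain ⟨B, hB, hBs⟩ := hsplit (Set ℕ) (𝒫 (Set.Iio k))
      (fun s => {x ∈ E | ∀ i < k, x ∈ A i ↔ i ∈ s}) (Set.finite_Iio k).finite_subsets
      (fun s _ => ⟨fun x hx => hx.1, hpos s⟩)
    refine ⟨Function.update A k B, fun i hi => ?_, fun s => ?_⟩
    · rcases Nat.lt_succ_iff_lt_or_eq.1 hi with h | rfl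
      · rw [Function.update_of_ne h.ne]
        exact hA i h
      · simpa using hB
    · have key := hBs (s ∩ Set.Iio k) Set.inter_subset_right
      have hupd : ∀ x, (∀ i < k, x ∈ A i ↔ i ∈ s ∩ Set.Iio k) → (x ∈ B ↔ k ∈ s) →
          ∀ i < k + 1, x ∈ Function.update A k B i ↔ i ∈ s := by
        intro x hx hxB i hi
        rcases Nat.lt_succ_iff_lt_or_eq.1 hi with h | rfl
        · rw [Function.update_of_ne h.ne, hx i h]
          simp [h]
        · simpa using hxB
      by_cases hk : k ∈ s
      · refine fun h0 => key.1 (measure_mono_null ?_ h0)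
        rintro x ⟨⟨hxE, hx⟩, hxB⟩
        exact ⟨hxE, hupd x hx (by simp [hk, hxB])⟩
      · refine fun h0 => key.2 (measure_mono_null ?_ h0)
        rintro x ⟨⟨hxE, hx⟩, hxB⟩
        exact ⟨hxE, hupd x hx (by simp [hk, hxB])⟩

end Osc

/-! ### Dual shattering and brackets -/

namespace VCBracketing

/-- Long independent sequences yield large shattered sets. -/
theorem exists_shatters_of_independent {X : Type*} {C : Set (Set X)}
    (h : ∀ k : ℕ, ∃ A : ℕ → Set X, (∀ i < k, A i ∈ C) ∧
      ∀ s : Set ℕ, ∃ x, ∀ i < k, x ∈ A i ↔ i ∈ s) (n : ℕ) :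
    ∃ D : Finset X, Shatters C D ∧ D.card = n := by
  classical
  let e := Fintype.equivFin (Finset (Fin n))
  obtain ⟨A, hA, hind⟩ := h (Fintype.card (Finset (Fin n)))
  choose pt hpt using hind
  -- The independent sets are labelled by the subsets of `Fin n`; `x i` is chosen in exactly those
  -- whose label contains `i`.
  let x : Fin n → X := fun i => pt {j | ∃ hj, i ∈ e.symm ⟨j, hj⟩}
  have hx : ∀ (i : Fin n) (S : Finset (Fin n)), x i ∈ A (e S) ↔ i ∈ S := by
    intro i S
    rw [hpt _ _ (e S).2]
    exact ⟨fun ⟨_, hi⟩ => by simpa using hi, fun hi => ⟨(e S).2, by simpa using hi⟩⟩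
  have hinj : Function.Injective x := by
    intro i j hij
    have := (hx j {i}).1 (hij ▸ (hx i {i}).2 (by simp))
    exact (Finset.mem_singleton.1 this).symm
  refine ⟨Finset.univ.image x, fun T hT => ?_, by
    rw [Finset.card_image_of_injective _ hinj, Finset.card_fin]⟩
  refine ⟨A (e (Finset.univ.filter fun i => x i ∈ T)), hA _ (e _).2, ?_⟩
  ext y
  constructor
  · rintro ⟨hyA, hy⟩
    obtain ⟨i, -, rfl⟩ := Finset.mem_image.1 (Finset.mem_coe.1 hy)
    simpa using (hx i _).1 hyA
  · intro hy
    obtain ⟨i, -, rfl⟩ := Finset.mem_image.1 (hT hy)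
    exact ⟨(hx i _).2 (by simpa using hy), by simp⟩

theorem vcDimension_eq_top {X : Type*} {C : Set (Set X)}
    (h : ∀ n : ℕ, ∃ D : Finset X, Shatters C D ∧ D.card = n) : vcDimension C = ⊤ := by
  refine ENat.eq_top_iff_forall_ge.2 fun n => ?_
  obtain ⟨D, hD, rfl⟩ := h n
  exact le_iSup (fun D : {D : Finset X // Shatters C D} => (D.1.card : ℕ∞)) ⟨D, hD⟩

/-- A countable VC class of measurable sets is coverable at every positive level. -/
theorem finOscCover_of_isVCClass {X : Type*} [MeasurableSpace X] {μ : Measure X}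
    [IsFiniteMeasure μ] {C C₀ : Set (Set X)} (hVC : IsVCClass C) (hsub : C₀ ⊆ C)
    (hC₀ : C₀.Countable) (hm : ∀ A ∈ C₀, MeasurableSet A) {e : ENNReal} (he : 0 < e) :
    FinOscCover μ e C₀ := by
  by_contra hnc
  refine hVC.ne (vcDimension_eq_top fun n => ?_)
  obtain ⟨D, hD, hn⟩ := exists_shatters_of_independent (exists_independent hC₀ hm he hnc) n
  refine ⟨D, fun T hT => ?_, hn⟩
  obtain ⟨A, hA, h⟩ := hD T hT
  exact ⟨A, hsub hA, h⟩

theorem isEpsBracket_sInter_sUnion {X : Type*} [MeasurableSpace X] {μ : Measure X} {ε : ℝ}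
    {G : Set (Set X)} (hG : G.Countable) (hm : ∀ A ∈ G, MeasurableSet A) (hne : G.Nonempty)
    (hμ : μ (oscSet G) ≤ ENNReal.ofReal ε) :
    IsEpsBracket μ ε ((⋂₀ G).indicator fun _ => (1 : ℝ)) ((⋃₀ G).indicator fun _ => (1 : ℝ)) := by
  obtain ⟨A, hA⟩ := hne
  have hsub : ⋂₀ G ⊆ ⋃₀ G := fun x hx => ⟨A, hA, hx A hA⟩
  refine ⟨measurable_const.indicator (MeasurableSet.sInter hG hm),
    measurable_const.indicator (MeasurableSet.sUnion hG hm),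
    fun x => Set.indicator_le_indicator_of_subset hsub (fun _ => zero_le_one) x, ?_⟩
  have : ∀ x, ENNReal.ofReal ((⋃₀ G).indicator (fun _ => (1 : ℝ)) x
      - (⋂₀ G).indicator (fun _ => (1 : ℝ)) x) = (oscSet G).indicator 1 x := by
    intro x
    by_cases h1 : x ∈ ⋃₀ G <;> by_cases h2 : x ∈ ⋂₀ G
    · simp [oscSet, h1, h2, -Set.mem_sUnion, -Set.mem_sInter]
    · simp [oscSet, h1, h2, -Set.mem_sUnion, -Set.mem_sInter]
    · exact absurd (hsub h2) h1
    · simp [oscSet, h1, h2, -Set.mem_sUnion, -Set.mem_sInter]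
  simp_rw [this]
  rwa [lintegral_indicator_one (measurableSet_oscSet hG hm)]

theorem indicator_one_injective {X : Type*} :
    Function.Injective fun A : Set X => A.indicator (fun _ => (1 : ℝ)) := by
  intro A B h
  ext x
  have := congrFun h x
  by_cases hA : x ∈ A <;> by_cases hB : x ∈ B <;> simp_all

end VCBracketing

theorem corollary1 {X : Type*} [MeasurableSpace X] (C : Set (Set X))
    (hmeas : ∀ A ∈ C, MeasurableSet A)
    (hVC : VCBracketing.IsVCClass C)
    (hsep : VCBracketing.IsSeparableFamily (VCBracketing.indicatorFamily C))
    (μ : Measure X) [IsProbabilityMeasure μ] (ε : ℝ) (hε : 0 < ε) :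
    VCBracketing.bracketingNumber ε (VCBracketing.indicatorFamily C) μ < ⊤ := by
  obtain ⟨F₀, hF₀, hcount, hlim⟩ := hsep
  let C₀ : Set (Set X) := {A ∈ C | A.indicator (fun _ => (1 : ℝ)) ∈ F₀}
  have hC₀ : C₀.Countable :=
    (hcount.preimage VCBracketing.indicator_one_injective).mono fun A hA => hA.2
  obtain ⟨T, hT, hcov, hb⟩ := VCBracketing.finOscCover_of_isVCClass (μ := μ) hVC
    (fun A hA => hA.1 : C₀ ⊆ C) hC₀ (fun A hA => hmeas A hA.1) (ENNReal.ofReal_pos.2 hε)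
  let br : Set (Set X) → (X → ℝ) × (X → ℝ) := fun G =>
    ((⋂₀ G).indicator fun _ => (1 : ℝ), (⋃₀ G).indicator fun _ => (1 : ℝ))
  let Θ : Set ((X → ℝ) × (X → ℝ)) := br '' {G ∈ T | G.Nonempty}
  have hΘ : Θ.Finite := (hT.subset fun G hG => hG.1).image _
  refine lt_of_le_of_lt (sInf_le ⟨Θ, ?_, ?_, rfl⟩) hΘ.encard_lt_top
  · rintro _ ⟨G, ⟨hG, hne⟩, rfl⟩
    exact VCBracketing.isEpsBracket_sInter_sUnion (hC₀.mono (hb G hG).1)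
      (fun A hA => hmeas A ((hb G hG).1 hA).1) hne (hb G hG).2
  · rintro _ ⟨A, hA, rfl⟩
    obtain ⟨u, hu, hconv⟩ := hlim _ ⟨A, hA, rfl⟩
    choose B hBC hBu using fun n => hF₀ (hu n)
    have hBu' : ∀ n, (B n).indicator (fun _ => (1 : ℝ)) = u n := hBu
    have hex : ∀ n, ∃ G ∈ T, B n ∈ G := fun n =>
      hcov ⟨hBC n, by rw [hBu']; exact hu n⟩
    -- One of the finitely many pieces contains infinitely many terms of the approximating sequence;
    -- its closed bracket then contains the limit.
    have hfreq : ∃ G ∈ T, ∃ᶠ n in atTop, B n ∈ G := by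
      by_contra! hno
      have hall : ∀ᶠ n in atTop, ∀ G ∈ T, B n ∉ G :=
        (eventually_all_finite hT).2 fun G hG => hno G hG
      obtain ⟨n, hn⟩ := hall.exists
      obtain ⟨G, hG, hBG⟩ := hex n
      exact hn G hG hBG
    obtain ⟨G, hG, hfr⟩ := hfreq
    obtain ⟨n, hn⟩ := hfr.exists
    refine Set.mem_biUnion (Set.mem_image_of_mem br ⟨hG, ⟨B n, hn⟩⟩)
      ⟨measurable_const.indicator (hmeas A hA), fun x => ?_⟩
    refine isClosed_Icc.mem_of_frequently_of_tendsto (hfr.mono fun n hn => ?_) (hconv x)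
    rw [← hBu' n]
    exact ⟨Set.indicator_le_indicator_of_subset (Set.sInter_subset_of_mem hn)
        (fun _ => zero_le_one) x,
      Set.indicator_le_indicator_of_subset (Set.subset_sUnion_of_mem hn)
        (fun _ => zero_le_one) x⟩
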